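/- For $s\in(1,2]$ let $T(x)=\min\{sx,s(1-x)\}$ be the tent map on $[0,1]$, with critical point $c=\tfrac12$, and put $c_k=T^k(c)$. Assume that the orbit of $c$ is infinite. Let $$X=\varprojlim([0,1],T)=\{(\dots,x_{-2},x_{-1},x_0)\in[0,1]^{\mathbb N_0}: T(x_{-i-1})=x_{-i}\text{ for all } i\ge 0\}$$ with the product topology, and let $X'=\varprojlim([c_2,c_1],T)\subset X$ be the core inverse limit space. Let $D_1=[c,c_1]$ and, for $n\ge1$, let $D_{n+1}$ be the closed interval with endpoints $c_{n+1}$ and $c_1$ if $c\in D_n$, and $D_{n+1}=T(D_n)$ if $c\notin D_n$. Assume that $T$ is long-branched, i.e. $\inf_n|D_n|>0$. A continuum is a non-empty compact connected metric space, and an arc is a space homeomorphic to $[0,1]$. Let $\mathcal E$ be the set of endpoints of $X$, i.e. of those $x\in X$ such that any two subcontinua $A,B\subset X$ containing $x$ satisfy $A\subset B$ or $B\subset A$. A sequence $\overleftarrow{e}=\dots e_{-2}e_{-1}\in\{0,1\}^{\mathbb N}$ is a left itinerary of $x$ if, for every $i\ge1$, $e_{-i}=0$ when $x_{-i}<c$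 and $e_{-i}=1$ when $x_{-i}>c$ (both symbols are allowed when $x_{-i}=c$); the basic arc $A(\overleftarrow{e})$ is the closure of the set of points of $X$ with left itinerary $\overleftarrow{e}$. Let $\mathcal E_F\subset\mathcal E$ be the set of flat endpoints, i.e. of those $x\in\mathcal E$ that have a left itinerary $\overleftarrow{e}$ such that $A(\overleftarrow{e})$ is a (non-degenerate) arc with $x$ as one of its two endpoints. Then: 1. if $s>\sqrt2$, then every proper subcontinuum of $X'$ that is not a single point is an arc; 2. $\mathcal E\cap X'\ne\emptyset$ if and only if $c$ is recurrent (that is, $c\in\omega(c)$); 3. if $c$ is recurrent, then all endpoints are flat, i.e. $\mathcal E=\mathcal E_F$. -/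

import Mathlib

open Set Filter Topology

noncomputable section

namespace TentInvLim

/-- The tent map `T_s(x) = min {s x, s (1 - x)}`, with critical point `c = 1/2`. -/
def tent (s x : ℝ) : ℝ := min (s * x) (s * (1 - x))

/-- The point `c_k = T^k(c)` of the critical orbit. -/
def crit (s : ℝ) (k : ℕ) : ℝ := (tent s)^[k] (1 / 2)

/-- The inverse limit of `T_s` over a set `J`, as a subset of the countable product `ℕ → ℝ`
with the product topology. The coordinate `x i` is the projection `π_i(x) = x_{-i}`. -/
def invLim (s : ℝ) (J : Set ℝ) : Set (ℕ → ℝ) :=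
  {x | (∀ i, x i ∈ J) ∧ ∀ i, tent s (x (i + 1)) = x i}

/-- `X`, the inverse limit of `T_s` on `[0, 1]`. -/
def space (s : ℝ) : Set (ℕ → ℝ) := invLim s (Icc 0 1)

/-- `X'`, the inverse limit of `T_s` on the core `[c_2, c_1]`. -/
def coreSpace (s : ℝ) : Set (ℕ → ℝ) := invLim s (Icc (crit s 2) (crit s 1))

open Classical in
/-- The levels of the Hofbauer tower: `D s n` is the interval `D_{n+1}`, where `D_1 = [c, c_1]`,
and `D_{n+1}` is `[c_{n+1}, c_1]` if `c ∈ D_n` and `T(D_n)` otherwise. -/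
def D (s : ℝ) : ℕ → Set ℝ
  | 0 => uIcc (1 / 2) (crit s 1)
  | n + 1 => if (1 / 2 : ℝ) ∈ D s n then uIcc (crit s (n + 2)) (crit s 1) else tent s '' D s n

/-- `T_s` is long-branched: `inf_n |D_n| > 0`. -/
def LongBranched (s : ℝ) : Prop := ∃ δ > 0, ∀ n, δ ≤ Metric.diam (D s n)

/-- The critical point is recurrent: `c ∈ ω(c)`. -/
def CritRecurrent (s : ℝ) : Prop := MapClusterPt (1 / 2) atTop (crit s)

/-- `H` is a subcontinuum of `K`: a nonempty compact connected subset. -/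
def IsSubcontinuum {E : Type*} [TopologicalSpace E] (H K : Set E) : Prop :=
  H ⊆ K ∧ IsCompact H ∧ IsConnected H

/-- `A` is a (non-degenerate) arc. -/
def IsArc {E : Type*} [TopologicalSpace E] (A : Set E) : Prop :=
  Nonempty (unitInterval ≃ₜ A)

/-- `A` is a (non-degenerate) arc and `x` is one of its two endpoints. -/
def IsArcEnd {E : Type*} [TopologicalSpace E] (A : Set E) (x : E) : Prop :=
  ∃ h : unitInterval ≃ₜ A, (h 0 : E) = x

/-- The endpoints of a (chainable) continuum `K`: the points `x` such that any two subcontinua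
of `K` that contain `x` are nested. -/
def endpoints {E : Type*} [TopologicalSpace E] (K : Set E) : Set E :=
  {x | x ∈ K ∧ ∀ A B : Set E, IsSubcontinuum A K → IsSubcontinuum B K → x ∈ A → x ∈ B →
    A ⊆ B ∨ B ⊆ A}

/-- The sequence `… e 1, e 0`, where `e i` is the symbol `s_{-(i+1)}` (`false` for `0` and `true`
for `1`), is a left itinerary of `x`. Both symbols are allowed where `x_{-(i+1)} = c`. -/
def IsLeftItinerary (x : ℕ → ℝ) (e : ℕ → Bool) : Prop :=
  ∀ i, (x (i + 1) < 1 / 2 → e i = false) ∧ (1 / 2 < x (i + 1) → e i = true)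

/-- The basic arc `A(e)`: the closure of the set of points of `X` with left itinerary `e`. -/
def basicArc (s : ℝ) (e : ℕ → Bool) : Set (ℕ → ℝ) :=
  closure {x | x ∈ space s ∧ IsLeftItinerary x e}

/-- The set of flat endpoints of `X`: the endpoints of `X` that are endpoints of
their own basic arc, this basic arc being non-degenerate. -/
def flatEndpoints (s : ℝ) : Set (ℕ → ℝ) :=
  {x | x ∈ endpoints (space s) ∧
    ∃ e : ℕ → Bool, IsLeftItinerary x e ∧ IsArcEnd (basicArc s e) x}

end TentInvLim

end

open Set Filter Topology

noncomputable section

namespace TentInvLim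

/-! ### The tent map -/

/-! Everything turns on folding at `1/2`, and the tower levels measure how long an interval can
remain after a fold. When a level is cut at `1/2`, the next one has length `s * |c_k - 1/2|`, so
long-branchedness keeps the endpoint `c_k` of a cut level away from `1/2`.

Arcs: if projections of a proper subcontinuum of the core met `1/2` at arbitrarily deep levels, then
at those levels they would have length at least `δ / s` (`exists_far_pair`). For `s > √2`, lengths
grow at least by `s² / 2 > 1` under every two applications of `T`, so deep projections are short, a
contradiction (`half_not_mem_proj_of_proper`). Beyond the last fold a single coordinate parametrizes
the continuum.

Recurrence: close returns of the critical orbit allow a limit of finite critical orbits read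
backwards, whose coordinates approach `c_1` faster than `s^{-m}`; this forces an endpoint
(`mem_endpoints_of_close`). Conversely, a non-recurrent orbit stays away from `1/2`. An endpoint has
all its coordinates near that orbit, yet some coordinate near `1/2`, since otherwise its inverse
branches would extend to both sides (`exists_crit_near_of_endpoint`).

Flatness: every finite itinerary condition leaves an interval of length at least `δ` around `x 0`
(`exists_stageInterval`), so every basic arc is non-degenerate. An endpoint of `X` cannot be
interior to it. -/

theorem tent_eq_sub_abs {s : ℝ} (hs : 0 < s) (x : ℝ) : tent s x = s / 2 - s * |x - 1 / 2| := by
  unfold tent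
  rcases le_total x (1 / 2) with h | h
  · rw [abs_of_nonpos (by linarith), min_eq_left (by nlinarith)]; ring
  · rw [abs_of_nonneg (by linarith), min_eq_right (by nlinarith)]; ring

theorem tent_of_le {s x : ℝ} (hs : 0 < s) (h : x ≤ 1 / 2) : tent s x = s * x := by
  rw [tent_eq_sub_abs hs, abs_of_nonpos (by linarith)]; ring

theorem tent_of_ge {s x : ℝ} (hs : 0 < s) (h : 1 / 2 ≤ x) : tent s x = s * (1 - x) := by
  rw [tent_eq_sub_abs hs, abs_of_nonneg (by linarith)]; ring

theorem continuous_tent (s : ℝ) : Continuous (tent s) := by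
  unfold tent; fun_prop

theorem tent_le {s : ℝ} (hs : 0 < s) (x : ℝ) : tent s x ≤ s / 2 := by
  rw [tent_eq_sub_abs hs]
  have := mul_nonneg hs.le (abs_nonneg (x - 1 / 2))
  linarith

theorem abs_tent_sub_tent_le {s : ℝ} (hs : 0 < s) (x y : ℝ) :
    |tent s x - tent s y| ≤ s * |x - y| := by
  rw [tent_eq_sub_abs hs, tent_eq_sub_abs hs,
    show s / 2 - s * |x - 1 / 2| - (s / 2 - s * |y - 1 / 2|)
      = s * (|y - 1 / 2| - |x - 1 / 2|) by ring, abs_mul, abs_of_pos hs]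
  refine mul_le_mul_of_nonneg_left ?_ hs.le
  have := abs_abs_sub_abs_le_abs_sub (y - 1 / 2) (x - 1 / 2)
  rwa [show y - 1 / 2 - (x - 1 / 2) = y - x by ring, abs_sub_comm y x] at this

theorem abs_tent_sub_tent {s x y : ℝ} (hs : 0 < s) (h : 0 ≤ (x - 1 / 2) * (y - 1 / 2)) :
    |tent s x - tent s y| = s * |x - y| := by
  rw [tent_eq_sub_abs hs, tent_eq_sub_abs hs,
    show s / 2 - s * |x - 1 / 2| - (s / 2 - s * |y - 1 / 2|)
      = s * (|y - 1 / 2| - |x - 1 / 2|) by ring, abs_mul, abs_of_pos hs]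
  congr 1
  rcases mul_nonneg_iff.1 h with ⟨h1, h2⟩ | ⟨h1, h2⟩
  · rw [abs_of_nonneg h1, abs_of_nonneg h2, abs_sub_comm]; congr 1; ring
  · rw [abs_of_nonpos h1, abs_of_nonpos h2]; congr 1; ring

theorem abs_iterate_tent_sub_le {s : ℝ} (hs : 0 < s) (k : ℕ) (x y : ℝ) :
    |(tent s)^[k] x - (tent s)^[k] y| ≤ s ^ k * |x - y| := by
  induction k with
  | zero => simp
  | succ k ih =>
    rw [Function.iterate_succ_apply', Function.iterate_succ_apply', pow_succ']
    calc _ ≤ s * |(tent s)^[k] x - (tent s)^[k] y| := abs_tent_sub_tent_le hs _ _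
      _ ≤ s * (s ^ k * |x - y|) := mul_le_mul_of_nonneg_left ih hs.le
      _ = _ := by ring

theorem tent_mapsTo {s : ℝ} (hs : 0 < s) (hs2 : s ≤ 2) {x : ℝ} (hx : x ∈ Icc (0 : ℝ) 1) :
    tent s x ∈ Icc (0 : ℝ) 1 :=
  ⟨le_min (mul_nonneg hs.le hx.1) (mul_nonneg hs.le (by linarith [hx.2])),
    (tent_le hs x).trans (by linarith)⟩

/-! ### The critical orbit -/

theorem crit_succ (s : ℝ) (k : ℕ) : crit s (k + 1) = tent s (crit s k) :=
  Function.iterate_succ_apply' _ _ _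

theorem crit_zero (s : ℝ) : crit s 0 = 1 / 2 := rfl

theorem crit_one {s : ℝ} (hs : 0 < s) : crit s 1 = s / 2 := by
  rw [crit_succ, crit_zero, tent_of_le hs le_rfl]; ring

theorem crit_two {s : ℝ} (hs1 : 1 < s) : crit s 2 = s * (1 - s / 2) := by
  rw [crit_succ, crit_one (by linarith), tent_of_ge (by linarith) (by linarith)]

theorem crit_two_lt {s : ℝ} (hs1 : 1 < s) : crit s 2 < 1 / 2 := by
  rw [crit_two hs1]; nlinarith [sq_pos_of_pos (sub_pos.2 hs1)]

theorem iterate_tent_crit (s : ℝ) (k n : ℕ) : (tent s)^[k] (crit s n) = crit s (n + k) := by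
  rw [crit, crit, ← Function.iterate_add_apply, add_comm]

theorem crit_ne_of_infinite {s : ℝ} (hinf : (range (crit s)).Infinite) (k : ℕ) :
    crit s (k + 1) ≠ 1 / 2 := by
  intro h
  refine hinf (((Finset.range (k + 1)).finite_toSet.image (crit s)).subset ?_)
  rintro _ ⟨n, rfl⟩
  have hp : Function.IsPeriodicPt (tent s) (k + 1) (1 / 2) := h
  exact ⟨n % (k + 1), by simpa using Nat.mod_lt _ k.succ_pos, hp.iterate_mod_apply n⟩

theorem lt_two_of_infinite {s : ℝ} (hs2 : s ≤ 2) (hinf : (range (crit s)).Infinite) : s < 2 := by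
  refine lt_of_le_of_ne hs2 ?_
  rintro rfl
  have h2 : ∀ n, crit 2 (n + 2) = 0 := by
    intro n
    induction n with
    | zero => rw [crit_two (by norm_num)]; norm_num
    | succ n ih => rw [show n + 1 + 2 = n + 2 + 1 by ring, crit_succ, ih]; norm_num [tent]
  refine hinf ((((Finset.range 3)).finite_toSet.image (crit 2)).subset ?_)
  rintro _ ⟨n, rfl⟩
  rcases lt_or_ge n 3 with h | h
  · exact ⟨n, by simpa using h, rfl⟩
  · obtain ⟨m, rfl⟩ := Nat.exists_eq_add_of_le' (show 2 ≤ n by omega)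
    exact ⟨2, by simp, (h2 0).trans (h2 m).symm⟩

theorem crit_two_pos {s : ℝ} (hs1 : 1 < s) (hs : s < 2) : 0 < crit s 2 := by
  rw [crit_two hs1]; exact mul_pos (by linarith) (by linarith)

theorem core_subset {s : ℝ} (hs1 : 1 < s) (hs2 : s ≤ 2) :
    Icc (crit s 2) (crit s 1) ⊆ Icc 0 1 := by
  rw [crit_two hs1, crit_one (by linarith)]
  exact Icc_subset_Icc (mul_nonneg (by linarith) (by linarith)) (by linarith)

theorem tent_mapsTo_core {s : ℝ} (hs1 : 1 < s) (hs2 : s ≤ 2) {x : ℝ}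
    (hx : x ∈ Icc (crit s 2) (crit s 1)) : tent s x ∈ Icc (crit s 2) (crit s 1) := by
  have hs : 0 < s := by linarith
  have h01 := core_subset hs1 hs2 hx
  rw [crit_two hs1, crit_one hs] at *
  refine ⟨le_min ?_ ?_, tent_le hs x⟩
  · have h1 : s * (1 - s / 2) ≤ x := hx.1
    have : 0 ≤ s * (1 - s / 2) := mul_nonneg hs.le (by linarith)
    nlinarith [h01.1]
  · exact mul_le_mul_of_nonneg_left (by linarith [hx.2]) hs.le

theorem crit_mem_core {s : ℝ} (hs1 : 1 < s) (hs2 : s ≤ 2) (k : ℕ) :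
    crit s k ∈ Icc (crit s 2) (crit s 1) := by
  induction k with
  | zero =>
    rw [crit_zero]
    exact ⟨(crit_two_lt hs1).le, by rw [crit_one (by linarith)]; linarith⟩
  | succ k ih => rw [crit_succ s k]; exact tent_mapsTo_core hs1 hs2 ih

theorem coreSpace_subset {s : ℝ} (hs1 : 1 < s) (hs2 : s ≤ 2) : coreSpace s ⊆ space s :=
  fun _ hx => ⟨fun i => core_subset hs1 hs2 (hx.1 i), hx.2⟩

/-! ### Points and closed subsets of the inverse limit -/

theorem iterate_tent_invLim {s : ℝ} {J : Set ℝ} {x : ℕ → ℝ} (hx : x ∈ invLim s J) (n k : ℕ) :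
    (tent s)^[k] (x (n + k)) = x n := by
  induction k with
  | zero => rfl
  | succ k ih => rw [Function.iterate_succ_apply, ← add_assoc, hx.2, ih]

theorem eq_of_le_of_eq {s : ℝ} {J : Set ℝ} {x y : ℕ → ℝ} (hx : x ∈ invLim s J)
    (hy : y ∈ invLim s J) {n i : ℕ} (h : x n = y n) (hi : i ≤ n) : x i = y i := by
  obtain ⟨k, rfl⟩ := Nat.exists_eq_add_of_le hi
  rw [← iterate_tent_invLim hx i k, ← iterate_tent_invLim hy i k, h]

theorem isClosed_invLim (s : ℝ) {J : Set ℝ} (hJ : IsClosed J) : IsClosed (invLim s J) := by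
  have : invLim s J = (⋂ i, {x : ℕ → ℝ | x i ∈ J}) ∩ ⋂ i, {x | tent s (x (i + 1)) = x i} := by
    ext x; simp [invLim]
  rw [this]
  exact (isClosed_iInter fun i => hJ.preimage (continuous_apply i)).inter
    (isClosed_iInter fun i => isClosed_eq ((continuous_tent s).comp (continuous_apply _))
      (continuous_apply i))

/-- Agreement at coordinate `n` forces agreement at all smaller ones, so the chosen points converge
to `x`. Closed subsets are thus determined by their projections. -/
theorem mem_of_forall_proj_mem {s : ℝ} {J : Set ℝ} {B : Set (ℕ → ℝ)} (hB : IsClosed B)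
    (hBJ : B ⊆ invLim s J) {x : ℕ → ℝ} (hx : x ∈ invLim s J) (h : ∀ n, ∃ b ∈ B, b n = x n) :
    x ∈ B := by
  choose b hb hbx using h
  refine hB.mem_of_tendsto (f := b) (b := atTop) ?_ (Eventually.of_forall hb)
  rw [tendsto_pi_nhds]
  intro i
  refine tendsto_const_nhds.congr' ?_
  filter_upwards [eventually_ge_atTop i] with n hn
  exact (eq_of_le_of_eq (hBJ (hb n)) hx (hbx n) hn).symm

/-- One coordinate `N` already separates some `a` from the compact set `B`. As `T^k` is
`s^k`-Lipschitz, the gap at depth `m` decays no faster than `s^{-m}`. -/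
theorem exists_separation {s : ℝ} (hs : 0 < s) {J : Set ℝ} {A B : Set (ℕ → ℝ)}
    (hAJ : A ⊆ invLim s J) (hB : IsCompact B) (hBJ : B ⊆ invLim s J) (h : ¬ A ⊆ B) :
    ∃ N, ∃ α > 0, ∃ a ∈ A, ∀ b ∈ B, ∀ m ≥ N, α ≤ s ^ m * |a m - b m| := by
  obtain ⟨a, ha, haB⟩ := not_subset.1 h
  obtain ⟨N, hN⟩ : ∃ N, ∀ b ∈ B, b N ≠ a N := by
    by_contra! hcon
    exact haB (mem_of_forall_proj_mem hB.isClosed hBJ (hAJ ha) hcon)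
  have hK : IsClosed ((fun x : ℕ → ℝ => x N) '' B) := (hB.image (continuous_apply N)).isClosed
  have haK : a N ∉ (fun x : ℕ → ℝ => x N) '' B := by
    rintro ⟨b, hb, hba⟩; exact hN b hb hba
  obtain ⟨ε, hε, hball⟩ := Metric.isOpen_iff.1 hK.isOpen_compl _ haK
  refine ⟨N, s ^ N * ε, by positivity, a, ha, fun b hb m hm => ?_⟩
  have h1 : ε ≤ |a N - b N| := by
    by_contra! hlt
    exact hball (by rwa [Metric.mem_ball, Real.dist_eq, abs_sub_comm]) ⟨b, hb, rfl⟩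
  obtain ⟨k, rfl⟩ := Nat.exists_eq_add_of_le hm
  have h2 := abs_iterate_tent_sub_le hs k (a (N + k)) (b (N + k))
  rw [iterate_tent_invLim (hAJ ha), iterate_tent_invLim (hBJ hb)] at h2
  rw [pow_add, mul_assoc]
  exact mul_le_mul_of_nonneg_left (h1.trans h2) (by positivity)

theorem ordConnected_proj {A K : Set (ℕ → ℝ)} (hA : IsSubcontinuum A K) (n : ℕ) :
    OrdConnected ((fun x : ℕ → ℝ => x n) '' A) :=
  (hA.2.2.isPreconnected.image _ (continuous_apply n).continuousOn).ordConnected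

/-- A point whose coordinates come closer to the critical value `c_1` than the contraction rate
of the inverse branches is an endpoint. -/
theorem mem_endpoints_of_close {s : ℝ} (hs : 0 < s) {x : ℕ → ℝ} (hx : x ∈ space s)
    (h : ∀ N, ∀ α > 0, ∃ m ≥ N, s ^ m * (s / 2 - x m) < α) : x ∈ endpoints (space s) := by
  refine ⟨hx, fun A B hA hB hxA hxB => ?_⟩
  by_contra! hcon
  obtain ⟨N₁, α₁, hα₁, a, ha, hsep₁⟩ := exists_separation hs hA.1 hB.2.1 hB.1 hcon.1
  obtain ⟨N₂, α₂, hα₂, b, hb, hsep₂⟩ := exists_separation hs hB.1 hA.2.1 hA.1 hcon.2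
  obtain ⟨m, hm, hlt⟩ := h (max N₁ N₂) (min α₁ α₂) (lt_min hα₁ hα₂)
  -- No coordinate exceeds `s / 2`, and there is less than the separation distance between `x m` and
  -- `s / 2`; hence separated points lie to the left of `x m`.
  have key : ∀ y ∈ space s, min α₁ α₂ ≤ s ^ m * |y m - x m| → y m ≤ x m := by
    intro y hy hyx
    by_contra! hlt'
    rw [abs_of_pos (sub_pos.2 hlt')] at hyx
    have : y m ≤ s / 2 := by rw [← hy.2 m]; exact tent_le hs _
    have := mul_le_mul_of_nonneg_left (sub_le_sub_right this (x m)) (pow_pos hs m).le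
    linarith
  have hax := key a (hA.1 ha) ((min_le_left _ _).trans (hsep₁ x hxB m ((le_max_left _ _).trans hm)))
  have hbx := key b (hB.1 hb)
    ((min_le_right _ _).trans (hsep₂ x hxA m ((le_max_right _ _).trans hm)))
  -- Whichever of `a m`, `b m` is nearer to `x m` lies in the projection of the other continuum,
  -- contrary to separation.
  rcases le_total (a m) (b m) with hab | hab
  · obtain ⟨a', ha', he⟩ := (ordConnected_proj hA m).out ⟨a, ha, rfl⟩ ⟨x, hxA, rfl⟩ ⟨hab, hbx⟩
    have := hsep₂ a' ha' m ((le_max_right _ _).trans hm)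
    simp only [] at he
    rw [he, sub_self, abs_zero, mul_zero] at this
    linarith
  · obtain ⟨b', hb', he⟩ := (ordConnected_proj hB m).out ⟨b, hb, rfl⟩ ⟨x, hxB, rfl⟩ ⟨hab, hax⟩
    have := hsep₁ b' hb' m ((le_max_left _ _).trans hm)
    simp only [] at he
    rw [he, sub_self, abs_zero, mul_zero] at this
    linarith

/-! ### Recurrence produces an endpoint -/

theorem exists_crit_near {s : ℝ} (hrec : CritRecurrent s) {ε : ℝ} (hε : 0 < ε) :
    ∃ k ≥ 1, |crit s k - 1 / 2| < ε := by
  have := (mapClusterPt_iff_frequently.1 hrec) _ (Metric.ball_mem_nhds _ hε)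
  obtain ⟨k, hk, h⟩ := frequently_atTop.1 this 1
  exact ⟨k, hk, by rwa [Metric.mem_ball, Real.dist_eq] at h⟩

/-- Each return time is chosen after `n i`, so close that even the expansion `s ^ n i` leaves a
summable error. -/
theorem exists_return_levels {s : ℝ} (hs : 0 < s) (hrec : CritRecurrent s) :
    ∃ n : ℕ → ℕ, ∀ i, n i < n (i + 1) ∧
      s ^ n i * |crit s (n (i + 1) - n i) - 1 / 2| ≤ 1 / 2 / 2 ^ i := by
  have step : ∀ i m : ℕ, ∃ k ≥ 1, s ^ m * |crit s k - 1 / 2| ≤ 1 / 2 / 2 ^ i := by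
    intro i m
    obtain ⟨k, hk, h⟩ := exists_crit_near hrec
      (show 0 < (1 / 2 / 2 ^ i : ℝ) / s ^ m by positivity)
    refine ⟨k, hk, ?_⟩
    rw [lt_div_iff₀ (by positivity)] at h
    linarith
  choose k hk h using step
  refine ⟨fun i => Nat.rec 0 (fun i m => m + k i m) i, fun i => ⟨?_, ?_⟩⟩
  · exact Nat.lt_add_of_pos_right (hk _ _)
  · simpa using h i _

theorem exists_endpoint_of_recurrent {s : ℝ} (hs1 : 1 < s) (hs2 : s ≤ 2)
    (hrec : CritRecurrent s) : (endpoints (space s) ∩ coreSpace s).Nonempty := by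
  have hs : 0 < s := by linarith
  obtain ⟨n, hn⟩ := exists_return_levels hs hrec
  have hmono : StrictMono n := strictMono_nat_of_lt_succ fun i => (hn i).1
  -- Compare the images of `c_0` and `c_{n (i+1) - n i}` under `T^{n i - j}`: the factor `s^{n i -
  -- j}` times `s^j` is `s^{n i}`, so the bound does not depend on `j`.
  have hstep : ∀ i j, j ≤ n i →
      s ^ j * |crit s (n i - j) - crit s (n (i + 1) - j)| ≤ 1 / 2 / 2 ^ i := by
    intro i j hj
    have h1 := abs_iterate_tent_sub_le hs (n i - j) (crit s 0) (crit s (n (i + 1) - n i))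
    rw [iterate_tent_crit, iterate_tent_crit, zero_add,
      show n (i + 1) - n i + (n i - j) = n (i + 1) - j by have := (hn i).1; omega,
      crit_zero, abs_sub_comm (1 / 2)] at h1
    calc _ ≤ s ^ j * (s ^ (n i - j) * |crit s (n (i + 1) - n i) - 1 / 2|) :=
          mul_le_mul_of_nonneg_left h1 (by positivity)
      _ = s ^ n i * |crit s (n (i + 1) - n i) - 1 / 2| := by
          rw [← mul_assoc, ← pow_add, Nat.add_sub_cancel' hj]
      _ ≤ _ := (hn i).2
  have hlim : ∀ j, ∃ y, Tendsto (fun i => crit s (n i - j)) atTop (𝓝 y) ∧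
      ∀ i, j ≤ n i → s ^ j * |crit s (n i - j) - y| ≤ 1 / 2 ^ i := by
    intro j
    let f : ℕ → ℕ → ℝ := fun a i => s ^ j * crit s (n (i + a) - j)
    have hd : ∀ a, j ≤ n a → ∀ i, dist (f a i) (f a (i + 1)) ≤ 1 / 2 ^ a / 2 / 2 ^ i := by
      intro a ha i
      have := hstep (i + a) j (ha.trans (hmono.monotone (Nat.le_add_left _ _)))
      rw [Real.dist_eq]
      simp only [f]
      rw [← mul_sub, abs_mul, abs_of_pos (by positivity : 0 < s ^ j),
        show i + 1 + a = i + a + 1 by ring]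
      refine this.trans (le_of_eq ?_)
      rw [pow_add]; field_simp
    have hj0 : j ≤ n j := hmono.le_apply
    obtain ⟨z, hz⟩ := cauchySeq_tendsto_of_complete (cauchySeq_of_le_geometric_two (hd j hj0))
    have hzz : Tendsto (fun i => s ^ j * crit s (n i - j)) atTop (𝓝 z) :=
      (tendsto_add_atTop_iff_nat (f := fun i => s ^ j * crit s (n i - j)) j).1 hz
    refine ⟨z / s ^ j, ?_, fun i hi => ?_⟩
    · refine (hzz.div_const (s ^ j)).congr fun i => ?_
      field_simp
    · have hz' : Tendsto (f i) atTop (𝓝 z) :=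
        (tendsto_add_atTop_iff_nat (f := fun i => s ^ j * crit s (n i - j)) i).2 hzz
      have h0 := dist_le_of_le_geometric_two_of_tendsto₀ (hd i hi) hz'
      rw [Real.dist_eq] at h0
      simp only [f, zero_add] at h0
      rw [← abs_of_pos (by positivity : 0 < s ^ j), ← abs_mul, abs_of_pos (by positivity : 0 < s ^ j),
        mul_sub, mul_div_cancel₀ _ (by positivity)]
      exact h0
  choose x hx hxd using hlim
  have hxcore : x ∈ coreSpace s := by
    refine ⟨fun j => isClosed_Icc.mem_of_tendsto (hx j)
      (Eventually.of_forall fun i => crit_mem_core hs1 hs2 _), fun j => ?_⟩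
    refine tendsto_nhds_unique (((continuous_tent s).tendsto _).comp (hx (j + 1))) ?_
    refine (hx j).congr' ?_
    filter_upwards [eventually_ge_atTop (j + 1)] with i hi
    have : j + 1 ≤ n i := hi.trans hmono.le_apply
    rw [Function.comp_apply, ← crit_succ]
    congr 1; omega
  refine ⟨x, mem_endpoints_of_close hs (coreSpace_subset hs1 hs2 hxcore) fun N α hα => ?_, hxcore⟩
  obtain ⟨i, hi⟩ := exists_pow_lt_of_lt_one hα (show (1 / 2 : ℝ) < 1 by norm_num)
  have hi' : N + i + 1 ≤ n (N + i + 1) := hmono.le_apply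
  -- At depth `n i - 1` the approximating orbit sits at `c_1 = s / 2`, the value required by the
  -- endpoint criterion.
  refine ⟨n (N + i + 1) - 1, by omega, ?_⟩
  have h1 := hxd (n (N + i + 1) - 1) (N + i + 1) (by omega)
  rw [show n (N + i + 1) - (n (N + i + 1) - 1) = 1 by omega, crit_one hs] at h1
  calc _ ≤ s ^ (n (N + i + 1) - 1) * |s / 2 - x (n (N + i + 1) - 1)| :=
        mul_le_mul_of_nonneg_left (le_abs_self _) (by positivity)
    _ ≤ 1 / 2 ^ (N + i + 1) := h1
    _ ≤ (1 / 2) ^ i := by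
        rw [div_pow, one_pow]
        exact one_div_le_one_div_of_le (by positivity)
          (pow_le_pow_right₀ (by norm_num) (by omega))
    _ < α := hi

/-! ### Affine inverse branches -/

/-- The sequence of preimages of `t` along the inverse branches prescribed by `e`. -/
def branch (s : ℝ) (e : ℕ → Bool) (t : ℝ) : ℕ → ℝ
  | 0 => t
  | n + 1 => if e n then 1 - branch s e t n / s else branch s e t n / s

/-- `y` lies in the closed half of the line coded by the symbol `b`. -/
def OnSide (b : Bool) (y : ℝ) : Prop := (y < 1 / 2 → b = false) ∧ (1 / 2 < y → b = true)

theorem onSide_iff {b : Bool} {y : ℝ} : OnSide b y ↔ if b then 1 / 2 ≤ y else y ≤ 1 / 2 := by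
  cases b <;> simp [OnSide]

theorem branch_succ (s : ℝ) (e : ℕ → Bool) (t : ℝ) (n : ℕ) :
    branch s e t (n + 1) = if e n then 1 - branch s e t n / s else branch s e t n / s := rfl

theorem continuous_branch (s : ℝ) (e : ℕ → Bool) : Continuous (branch s e) := by
  refine continuous_pi fun n => ?_
  induction n with
  | zero => exact continuous_id
  | succ n ih =>
    cases h : e n <;> simp only [branch_succ, h] <;> simp <;> fun_prop

theorem abs_branch_sub {s : ℝ} (hs : 0 < s) (e : ℕ → Bool) (t u : ℝ) (n : ℕ) :
    |branch s e t n - branch s e u n| = |t - u| / s ^ n := by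
  induction n with
  | zero => simp [branch]
  | succ n ih =>
    have : |branch s e t (n + 1) - branch s e u (n + 1)|
        = |branch s e t n - branch s e u n| / s := by
      rw [branch_succ, branch_succ]
      split_ifs
      · rw [show 1 - branch s e t n / s - (1 - branch s e u n / s)
          = (branch s e u n - branch s e t n) / s by ring, abs_div, abs_of_pos hs, abs_sub_comm]
      · rw [← sub_div, abs_div, abs_of_pos hs]
    rw [this, ih, pow_succ, div_div]

theorem div_mem_uIcc {s x y z : ℝ} (hs : 0 < s) (h : x ∈ uIcc y z) : x / s ∈ uIcc (y / s) (z / s) := by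
  rw [mem_uIcc] at *
  rcases h with h | h
  · exact Or.inl ⟨by have := h.1; gcongr, by have := h.2; gcongr⟩
  · exact Or.inr ⟨by have := h.1; gcongr, by have := h.2; gcongr⟩

theorem branch_mem_uIcc {s : ℝ} (hs : 0 < s) (e : ℕ → Bool) {t u v : ℝ} (h : u ∈ uIcc t v) (n : ℕ) :
    branch s e u n ∈ uIcc (branch s e t n) (branch s e v n) := by
  induction n with
  | zero => exact h
  | succ n ih =>
    have := div_mem_uIcc hs ih
    simp only [branch_succ]
    split_ifs
    · rw [mem_uIcc] at *
      rcases this with h | h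
      · exact Or.inr ⟨by linarith [h.2], by linarith [h.1]⟩
      · exact Or.inl ⟨by linarith [h.2], by linarith [h.1]⟩
    · exact this

theorem tent_branch {s : ℝ} (hs : 0 < s) {e : ℕ → Bool} {t : ℝ} {n : ℕ}
    (h : OnSide (e n) (branch s e t (n + 1))) : tent s (branch s e t (n + 1)) = branch s e t n := by
  rw [onSide_iff] at h
  rw [branch_succ] at *
  split_ifs at * with he
  · rw [tent_of_ge hs h]; field_simp; ring
  · rw [tent_of_le hs h]; field_simp

theorem iterate_tent_branch {s : ℝ} (hs : 0 < s) {e : ℕ → Bool} {t : ℝ} {n : ℕ}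
    (h : ∀ i < n, OnSide (e i) (branch s e t (i + 1))) : (tent s)^[n] (branch s e t n) = t := by
  induction n with
  | zero => rfl
  | succ n ih =>
    rw [Function.iterate_succ_apply, tent_branch hs (h n n.lt_succ_self)]
    exact ih fun i hi => h i (hi.trans n.lt_succ_self)

theorem branch_apply_zero_eq {s : ℝ} (hs : 0 < s) {e : ℕ → Bool} {x : ℕ → ℝ}
    (hx : ∀ i, tent s (x (i + 1)) = x i) (he : IsLeftItinerary x e) : branch s e (x 0) = x := by
  ext n
  induction n with
  | zero => rfl
  | succ n ih =>
    have h : OnSide (e n) (x (n + 1)) := he n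
    rw [onSide_iff] at h
    rw [branch_succ, ih, ← hx n]
    split_ifs at * with hb
    · rw [tent_of_ge hs h]; field_simp; ring
    · rw [tent_of_le hs h]; field_simp

theorem exists_leftItinerary (x : ℕ → ℝ) : ∃ e, IsLeftItinerary x e := by
  classical
  exact ⟨fun i => decide (1 / 2 < x (i + 1)), fun i =>
    ⟨fun h => by simpa using h.le, fun h => by simpa using h⟩⟩

theorem branch_mem_space {s : ℝ} (hs : 0 < s) (hs2 : s ≤ 2) {e : ℕ → Bool} {t : ℝ}
    (h0 : ∀ n, 0 ≤ branch s e t n) (h : IsLeftItinerary (branch s e t) e) :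
    branch s e t ∈ space s := by
  have hT : ∀ n, tent s (branch s e t (n + 1)) = branch s e t n := fun n => tent_branch hs (h n)
  exact ⟨fun n => ⟨h0 n, by rw [← hT n]; exact (tent_le hs _).trans (by linarith)⟩, hT⟩

theorem isSubcontinuum_branch_image {s : ℝ} {e : ℕ → Bool} {a b : ℝ} (hab : a ≤ b)
    (h : ∀ u ∈ Icc a b, branch s e u ∈ space s) :
    IsSubcontinuum (branch s e '' Icc a b) (space s) :=
  ⟨image_subset_iff.2 h, isCompact_Icc.image (continuous_branch s e),
    (isConnected_Icc hab).image _ (continuous_branch s e).continuousOn⟩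

/-- The two subarcs on either side of `t` are not nested, since coordinate `0` is the parameter. -/
theorem branch_not_mem_endpoints {s : ℝ} {e : ℕ → Bool} {a b t : ℝ} (hat : a < t) (htb : t < b)
    (h : ∀ u ∈ Icc a b, branch s e u ∈ space s) : branch s e t ∉ endpoints (space s) := by
  intro hend
  rcases hend.2 _ _
    (isSubcontinuum_branch_image hat.le fun u hu => h u ⟨hu.1, hu.2.trans htb.le⟩)
    (isSubcontinuum_branch_image htb.le fun u hu => h u ⟨hat.le.trans hu.1, hu.2⟩)
    ⟨t, right_mem_Icc.2 hat.le, rfl⟩ ⟨t, left_mem_Icc.2 htb.le, rfl⟩ with hn | hn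
  · obtain ⟨u, hu, hue⟩ := hn ⟨a, left_mem_Icc.2 hat.le, rfl⟩
    have : u = a := congrFun hue 0
    linarith [hu.1]
  · obtain ⟨u, hu, hue⟩ := hn ⟨b, right_mem_Icc.2 htb.le, rfl⟩
    have : u = b := congrFun hue 0
    linarith [hu.2]

/-! ### Endpoints in the core force recurrence -/

/-- Without such a `k`, no inverse branch along the itinerary meets `1/2` for parameters near `x 0`,
and `x` is interior to an arc. -/
theorem exists_crit_near_of_endpoint {s : ℝ} (hs1 : 1 < s) (hs2 : s < 2) {x : ℕ → ℝ}
    (hx : x ∈ coreSpace s) (hend : x ∈ endpoints (space s)) {ε : ℝ} (hε : 0 < ε) :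
    ∃ k ≥ 1, |crit s k - x 0| ≤ ε ∧ |x k - 1 / 2| ≤ ε := by
  have hs : 0 < s := by linarith
  by_contra! hcon
  obtain ⟨e, he⟩ := exists_leftItinerary x
  have hbx := branch_apply_zero_eq hs hx.2 he
  -- Core coordinates are at least `c_2`, so moving them by at most `c_2` keeps them nonnegative.
  set η := min ε (crit s 2) with hη
  have hηpos : 0 < η := lt_min hε (crit_two_pos hs1 hs2)
  have hdist : ∀ t ∈ Icc (x 0 - η) (x 0 + η), ∀ n, |branch s e t n - x n| ≤ η := by
    intro t ht n
    have h1 := abs_branch_sub hs e t (x 0) n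
    rw [hbx] at h1
    rw [h1]
    have h2 : |t - x 0| ≤ η := abs_le.2 ⟨by linarith [ht.1], by linarith [ht.2]⟩
    exact (div_le_self (abs_nonneg _) (one_le_pow₀ hs1.le)).trans h2
  have hx0 : x 0 ∈ Icc (x 0 - η) (x 0 + η) := ⟨by linarith, by linarith⟩
  have hside : ∀ n, ∀ t ∈ Icc (x 0 - η) (x 0 + η), OnSide (e n) (branch s e t (n + 1)) := by
    intro n
    induction n using Nat.strong_induction_on with
    | _ n ih =>
      intro t ht
      by_contra hnot
      have hxs : OnSide (e n) (x (n + 1)) := he n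
      have hmem : (1 / 2 : ℝ) ∈ uIcc (branch s e t (n + 1)) (branch s e (x 0) (n + 1)) := by
        rw [hbx, mem_uIcc]
        rw [onSide_iff] at hnot hxs
        split_ifs at * with hb
        · exact Or.inl ⟨(not_le.1 hnot).le, hxs⟩
        · exact Or.inr ⟨hxs, (not_le.1 hnot).le⟩
      -- A branch that changes side passes through `1/2` at some parameter `u`. Then `u = c_{n+1}`
      -- is near `x 0` while `x (n + 1)` is near `1/2`, which `hcon` forbids.
      obtain ⟨u, hu, hue⟩ := intermediate_value_uIcc
        (((continuous_apply (n + 1)).comp (continuous_branch s e)).continuousOn) hmem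
      simp only [Function.comp_apply] at hue
      have huI : u ∈ Icc (x 0 - η) (x 0 + η) := ordConnected_Icc.uIcc_subset ht hx0 hu
      have hit : (tent s)^[n + 1] (branch s e u (n + 1)) = u := by
        refine iterate_tent_branch hs fun i hi => ?_
        rcases Nat.lt_succ_iff_lt_or_eq.1 hi with hi | rfl
        · exact ih i hi u huI
        · rw [hue]; exact ⟨fun h => absurd h (lt_irrefl _), fun h => absurd h (lt_irrefl _)⟩
      rw [hue] at hit
      have hd := hdist u huI (n + 1)
      rw [hue, abs_sub_comm] at hd
      refine absurd (hd.trans (min_le_left _ _)) (not_le.2 (hcon (n + 1) (by omega) ?_))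
      rw [crit, hit, abs_le]
      have : η ≤ ε := min_le_left _ _
      exact ⟨by linarith [huI.1], by linarith [huI.2]⟩
  refine branch_not_mem_endpoints (e := e) (a := x 0 - η) (b := x 0 + η) (t := x 0) (s := s)
    (by linarith) (by linarith) (fun t ht => branch_mem_space hs hs2.le (fun n => ?_)
      fun n => hside n t ht) (by rwa [hbx])
  have h1 := (abs_le.1 (hdist t ht n)).1
  have h2 := (hx.1 n).1
  have : η ≤ crit s 2 := min_le_right _ _
  linarith

/-- `g` inverts the shift by prepending `tent s (y 0)`; being continuous and injective, it
transports subcontinua and reflects inclusions. -/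
theorem tail_mem_endpoints {s : ℝ} (hs : 0 < s) (hs2 : s ≤ 2) {x : ℕ → ℝ}
    (hx : x ∈ endpoints (space s)) : (fun i => x (i + 1)) ∈ endpoints (space s) := by
  have hxs := hx.1
  let g : (ℕ → ℝ) → ℕ → ℝ := fun y n => Nat.casesOn n (tent s (y 0)) y
  have hg : Continuous g := by
    refine continuous_pi fun n => ?_
    cases n with
    | zero => exact (continuous_tent s).comp (continuous_apply 0)
    | succ n => exact continuous_apply n
  have hsub : ∀ A, IsSubcontinuum A (space s) → IsSubcontinuum (g '' A) (space s) := by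
    refine fun A hA => ⟨?_, hA.2.1.image hg, hA.2.2.image _ hg.continuousOn⟩
    rintro _ ⟨y, hy, rfl⟩
    have hy' := hA.1 hy
    refine ⟨fun n => ?_, fun n => ?_⟩
    · cases n with
      | zero => exact tent_mapsTo hs hs2 (hy'.1 0)
      | succ n => exact hy'.1 n
    · cases n with
      | zero => rfl
      | succ n => exact hy'.2 n
  have hgx : g (fun i => x (i + 1)) = x := by
    ext n
    cases n with
    | zero => exact hxs.2 0
    | succ n => rfl
  have hinj : Function.Injective g := fun y z h => funext fun n => congrFun h (n + 1)
  refine ⟨⟨fun i => hxs.1 (i + 1), fun i => hxs.2 (i + 1)⟩, fun A B hA hB hxA hxB => ?_⟩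
  have := hx.2 _ _ (hsub A hA) (hsub B hB) ⟨_, hxA, hgx⟩ ⟨_, hxB, hgx⟩
  rwa [image_subset_image_iff hinj, image_subset_image_iff hinj] at this

theorem exists_crit_gap {s : ℝ} (hinf : (range (crit s)).Infinite) (h : ¬ CritRecurrent s) :
    ∃ η > 0, ∀ k ≥ 1, η ≤ |crit s k - 1 / 2| := by
  rw [CritRecurrent, mapClusterPt_iff_frequently] at h
  push Not at h
  obtain ⟨V, hV, hfreq⟩ := h
  obtain ⟨N, hN⟩ := eventually_atTop.1 hfreq
  have hfin : (crit s '' (Icc 1 N)).Finite := (finite_Icc 1 N).image _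
  have hmem : (1 / 2 : ℝ) ∈ (crit s '' (Icc 1 N))ᶜ := by
    rintro ⟨k, hk, hke⟩
    obtain ⟨j, rfl⟩ := Nat.exists_eq_add_of_le' hk.1
    exact crit_ne_of_infinite hinf j hke
  obtain ⟨η, hη, hball⟩ := Metric.mem_nhds_iff.1
    (inter_mem hV (hfin.isClosed.isOpen_compl.mem_nhds hmem))
  refine ⟨η, hη, fun k hk => ?_⟩
  by_contra! hlt
  have hk' := hball (show crit s k ∈ Metric.ball (1 / 2) η from hlt)
  rcases le_total k N with hkN | hkN
  · exact hk'.2 ⟨k, ⟨hk, hkN⟩, rfl⟩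
  · exact hN k hkN hk'.1

theorem recurrent_of_endpoint {s : ℝ} (hs1 : 1 < s) (hs2 : s < 2)
    (hinf : (range (crit s)).Infinite)
    (h : (endpoints (space s) ∩ coreSpace s).Nonempty) : CritRecurrent s := by
  have hs : 0 < s := by linarith
  by_contra hrec
  obtain ⟨η, hη, hgap⟩ := exists_crit_gap hinf hrec
  obtain ⟨x, hxe, hxc⟩ := h
  have htail : ∀ m, (fun i => x (i + m)) ∈ endpoints (space s) := by
    intro m
    induction m with
    | zero => exact hxe
    | succ m ih => simpa only [add_assoc, add_comm 1 m] using tail_mem_endpoints hs hs2.le ih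
  -- Applied to each tail, closeness `η / 3` to an orbit point at distance at least `η` from `1/2`
  -- leaves `2 * η / 3`. This beats the `η / 3` found below.
  have hfar : ∀ m, 2 * η / 3 ≤ |x m - 1 / 2| := by
    intro m
    obtain ⟨k, hk, h1, -⟩ := exists_crit_near_of_endpoint hs1 hs2 (x := fun i => x (i + m))
      ⟨fun i => hxc.1 (i + m), fun i => by simpa [add_right_comm] using hxc.2 (i + m)⟩ (htail m)
      (show 0 < η / 3 by positivity)
    have h2 := hgap k hk
    simp only [zero_add] at h1
    have h3 := abs_sub_le (crit s k) (x m) (1 / 2)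
    linarith
  obtain ⟨k, -, -, h2⟩ := exists_crit_near_of_endpoint hs1 hs2 hxc hxe
    (show 0 < η / 3 by positivity)
  linarith [hfar k]

/-! ### Levels of the Hofbauer tower -/

theorem image_tent_uIcc {s a b : ℝ} (hs : 0 < s) (h : 0 ≤ (a - 1 / 2) * (b - 1 / 2)) :
    tent s '' uIcc a b = uIcc (tent s a) (tent s b) := by
  rcases mul_nonneg_iff.1 h with ⟨ha, hb⟩ | ⟨ha, hb⟩
  · have hc : ∀ x ∈ uIcc a b, tent s x = s * (1 - x) := fun x hx =>
      tent_of_ge hs ((le_min (by linarith) (by linarith)).trans hx.1)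
    rw [image_congr hc, hc a left_mem_uIcc, hc b right_mem_uIcc, ← image_const_mul_uIcc,
      ← image_const_sub_uIcc, image_image]
  · have hc : ∀ x ∈ uIcc a b, tent s x = s * x := fun x hx =>
      tent_of_le hs (hx.2.trans (max_le (by linarith) (by linarith)))
    rw [image_congr hc, hc a left_mem_uIcc, hc b right_mem_uIcc, ← image_const_mul_uIcc]

theorem image_tent_uIcc_half {s : ℝ} (hs : 0 < s) (a : ℝ) :
    tent s '' uIcc a (1 / 2) = uIcc (tent s a) (crit s 1) := by
  rw [image_tent_uIcc hs (by simp), crit_succ, crit_zero]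

theorem mul_nonneg_of_half_not_mem {J : Set ℝ} (hJ : OrdConnected J) (h : (1 / 2 : ℝ) ∉ J)
    {a b : ℝ} (ha : a ∈ J) (hb : b ∈ J) : 0 ≤ (a - 1 / 2) * (b - 1 / 2) := by
  rcases le_total a (1 / 2) with h1 | h1 <;> rcases le_total b (1 / 2) with h2 | h2
  · exact mul_nonneg_of_nonpos_of_nonpos (by linarith) (by linarith)
  · exact absurd (hJ.out ha hb ⟨h1, h2⟩) h
  · exact absurd (hJ.out hb ha ⟨h2, h1⟩) h
  · exact mul_nonneg (by linarith) (by linarith)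

theorem D_zero {s : ℝ} (hs1 : 1 < s) : D s 0 = Icc (1 / 2) (s / 2) := by
  rw [D, crit_one (by linarith), uIcc_of_le (by linarith)]

theorem D_succ_of_mem {s : ℝ} {n : ℕ} (h : (1 / 2 : ℝ) ∈ D s n) :
    D s (n + 1) = uIcc (crit s (n + 2)) (crit s 1) := by
  rw [D, if_pos h]

theorem D_succ_of_not_mem {s : ℝ} {n : ℕ} (h : (1 / 2 : ℝ) ∉ D s n) :
    D s (n + 1) = tent s '' D s n := by
  rw [D, if_neg h]

theorem exists_D_eq_uIcc {s : ℝ} (hs : 0 < s) (n : ℕ) : ∃ r, D s n = uIcc (crit s (n + 1)) r := by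
  induction n with
  | zero => exact ⟨1 / 2, by rw [D, uIcc_comm]⟩
  | succ n ih =>
    by_cases h : (1 / 2 : ℝ) ∈ D s n
    · exact ⟨_, D_succ_of_mem h⟩
    · obtain ⟨r, hr⟩ := ih
      rw [D_succ_of_not_mem h, hr]
      rw [hr] at h
      exact ⟨tent s r, by rw [image_tent_uIcc hs (mul_nonneg_of_half_not_mem ordConnected_uIcc h
        left_mem_uIcc right_mem_uIcc), crit_succ s (n + 1)]⟩

/-- When a level is cut at `1/2`, the next level is the image of the half containing `c_{n+1}`; the
infinite orbit ensures `c_{n+1} ≠ 1/2`, so that half is well defined. -/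
theorem tent_mem_D_succ {s : ℝ} (hs : 0 < s) (hinf : (range (crit s)).Infinite) {n : ℕ} {y : ℝ}
    (hy : y ∈ D s n) (hside : 0 ≤ (y - 1 / 2) * (crit s (n + 1) - 1 / 2)) :
    tent s y ∈ D s (n + 1) := by
  by_cases h : (1 / 2 : ℝ) ∈ D s n
  · rw [D_succ_of_mem h, crit_succ s (n + 1), ← image_tent_uIcc_half hs]
    refine mem_image_of_mem _ ?_
    obtain ⟨r, hr⟩ := exists_D_eq_uIcc hs n
    rw [hr, mem_uIcc] at hy h
    rw [mem_uIcc]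
    rcases lt_or_gt_of_ne (crit_ne_of_infinite hinf n) with hc | hc
    · have hy2 : y ≤ 1 / 2 := by
        by_contra! hlt
        exact absurd (mul_neg_of_pos_of_neg (sub_pos.2 hlt) (sub_neg.2 hc)) (not_lt.2 hside)
      refine Or.inl ⟨?_, hy2⟩
      rcases h with h | h
      · rcases hy with hy | hy
        · exact hy.1
        · linarith [hy.1, hy.2, h.1, h.2]
      · linarith [h.2]
    · have hy2 : 1 / 2 ≤ y := by
        by_contra! hlt
        exact absurd (mul_neg_of_neg_of_pos (sub_neg.2 hlt) (sub_pos.2 hc)) (not_lt.2 hside)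
      refine Or.inr ⟨hy2, ?_⟩
      rcases h with h | h
      · linarith [h.1]
      · rcases hy with hy | hy
        · linarith [hy.1, hy.2, h.1, h.2]
        · exact hy.2
  · rw [D_succ_of_not_mem h]; exact mem_image_of_mem _ hy

theorem diam_uIcc (a b : ℝ) : Metric.diam (uIcc a b) = |a - b| := by
  rw [uIcc, Real.diam_Icc min_le_max, max_sub_min_eq_abs, abs_sub_comm]

theorem le_abs_of_half_mem_D {s δ : ℝ} (hs : 0 < s) (hδ : ∀ n, δ ≤ Metric.diam (D s n)) {n : ℕ}
    (h : (1 / 2 : ℝ) ∈ D s n) : δ ≤ s * |crit s (n + 1) - 1 / 2| := by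
  have := hδ (n + 1)
  rw [D_succ_of_mem h, diam_uIcc, crit_succ s (n + 1), crit_succ s 0, crit_zero,
    abs_tent_sub_tent hs (by simp)] at this
  exact this

/-! ### Proper subcontinua of the core -/

/-- The projection of `H` to the `n`-th coordinate. -/
def proj (n : ℕ) (H : Set (ℕ → ℝ)) : Set ℝ := (fun x : ℕ → ℝ => x n) '' H

theorem tent_mem_proj {s : ℝ} {J : Set ℝ} {H : Set (ℕ → ℝ)} (hH : H ⊆ invLim s J) {n : ℕ} {y : ℝ}
    (hy : y ∈ proj (n + 1) H) : tent s y ∈ proj n H := by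
  obtain ⟨x, hx, rfl⟩ := hy
  exact ⟨x, hx, ((hH hx).2 n).symm⟩

theorem exists_tent_eq_of_mem_proj {s : ℝ} {J : Set ℝ} {H : Set (ℕ → ℝ)} (hH : H ⊆ invLim s J)
    {n : ℕ} {y : ℝ} (hy : y ∈ proj n H) : ∃ z ∈ proj (n + 1) H, tent s z = y := by
  obtain ⟨x, hx, rfl⟩ := hy
  exact ⟨x (n + 1), ⟨x, hx, rfl⟩, (hH hx).2 n⟩

/-- Pushing `1/2` down from level `m + k + 1` produces `c_1, c_2, …` in the projections. Strictly
between the two levels no projection is folded, so the tower follows them. The side condition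
matters only for `j = 0`, where `D_1` is the right half. -/
theorem crit_mem_proj_and_subset_D {s : ℝ} (hs1 : 1 < s) (hinf : (range (crit s)).Infinite)
    {J : Set ℝ} {H : Set (ℕ → ℝ)} (hH : IsSubcontinuum H (invLim s J)) {m k : ℕ}
    (hk : (1 / 2 : ℝ) ∈ proj (m + k + 1) H)
    (hnot : ∀ i, m < i → i ≤ m + k → (1 / 2 : ℝ) ∉ proj i H) :
    ∀ j l, j + l = k → crit s (j + 1) ∈ proj (m + l) H ∧
      ∀ y ∈ proj (m + l) H, 0 ≤ (y - 1 / 2) * (crit s (j + 1) - 1 / 2) → y ∈ D s j := by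
  have hs : 0 < s := by linarith
  intro j
  induction j with
  | zero =>
    rintro l hl
    obtain rfl : l = k := by omega
    refine ⟨by rw [crit_succ, crit_zero]; exact tent_mem_proj hH.1 hk, fun y hy hside => ?_⟩
    obtain ⟨z, -, rfl⟩ := exists_tent_eq_of_mem_proj hH.1 hy
    rw [crit_one hs] at hside
    rw [D_zero hs1]
    refine ⟨?_, tent_le hs z⟩
    by_contra! hlt
    exact absurd (mul_neg_of_neg_of_pos (sub_neg.2 hlt) (show 0 < s / 2 - 1 / 2 by linarith))
      (not_lt.2 hside)
  | succ j ih =>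
    intro l hl
    obtain ⟨h1, h2⟩ := ih (l + 1) (by omega)
    refine ⟨by rw [crit_succ s (j + 1)]; exact tent_mem_proj hH.1 h1, fun y hy _ => ?_⟩
    obtain ⟨z, hz, rfl⟩ := exists_tent_eq_of_mem_proj hH.1 hy
    have hside := mul_nonneg_of_half_not_mem (ordConnected_proj hH _)
      (hnot (m + (l + 1)) (by omega) (by omega)) hz h1
    exact tent_mem_D_succ hs hinf (h2 z hz hside) hside

/-- Use the first level above `m` whose projection contains `1/2`. The pair consists of the critical
orbit point arriving at level `m` and `1/2` itself, which then cuts the corresponding tower level.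
-/
theorem exists_far_pair {s δ : ℝ} (hs1 : 1 < s) (hinf : (range (crit s)).Infinite)
    (hδ : ∀ n, δ ≤ Metric.diam (D s n)) {J : Set ℝ} {H : Set (ℕ → ℝ)}
    (hH : IsSubcontinuum H (invLim s J)) {m n : ℕ} (hmn : m < n)
    (hm : (1 / 2 : ℝ) ∈ proj m H) (hn : (1 / 2 : ℝ) ∈ proj n H) :
    ∃ u ∈ proj m H, ∃ v ∈ proj m H, δ ≤ s * |u - v| := by
  classical
  have hex : ∃ k, (1 / 2 : ℝ) ∈ proj (m + k + 1) H :=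
    ⟨n - m - 1, by rwa [show m + (n - m - 1) + 1 = n by omega]⟩
  obtain ⟨h1, h2⟩ := crit_mem_proj_and_subset_D hs1 hinf hH (Nat.find_spec hex)
    (fun i hi hi' hcon => Nat.find_min hex (m := i - m - 1) (by omega)
      (by rwa [show m + (i - m - 1) + 1 = i by omega])) (Nat.find hex) 0 rfl
  exact ⟨_, h1, _, hm, le_abs_of_half_mem_D (by linarith) hδ (h2 _ hm (by simp))⟩

/-- A fold at `1/2` still leaves the longer of the two pieces, hence the factor `s / 2`; without a
fold the full factor `s` survives. -/
theorem exists_expanded_pair {s : ℝ} (hs : 0 < s) {J : Set ℝ} {H : Set (ℕ → ℝ)}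
    (hH : IsSubcontinuum H (invLim s J)) (n : ℕ) {u v : ℝ} (hu : u ∈ proj (n + 1) H)
    (hv : v ∈ proj (n + 1) H) :
    (∃ u' ∈ proj n H, ∃ v' ∈ proj n H, s / 2 * |u - v| ≤ |u' - v'|) ∧
    ((1 / 2 : ℝ) ∉ proj (n + 1) H → ∃ u' ∈ proj n H, ∃ v' ∈ proj n H, s * |u - v| ≤ |u' - v'|) := by
  have key : (1 / 2 : ℝ) ∉ proj (n + 1) H →
      ∃ u' ∈ proj n H, ∃ v' ∈ proj n H, s * |u - v| ≤ |u' - v'| := fun h =>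
    ⟨_, tent_mem_proj hH.1 hu, _, tent_mem_proj hH.1 hv, (abs_tent_sub_tent hs
      (mul_nonneg_of_half_not_mem (ordConnected_proj hH (n + 1)) h hu hv)).ge⟩
  refine ⟨?_, key⟩
  by_cases h : (1 / 2 : ℝ) ∈ proj (n + 1) H
  · have h3 := abs_sub_le u (1 / 2) v
    rw [abs_sub_comm (1 / 2) v] at h3
    rcases le_total |u - 1 / 2| |v - 1 / 2| with hle | hle
    · refine ⟨_, tent_mem_proj hH.1 hv, _, tent_mem_proj hH.1 h, ?_⟩
      rw [abs_tent_sub_tent hs (by simp)]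
      nlinarith
    · refine ⟨_, tent_mem_proj hH.1 hu, _, tent_mem_proj hH.1 h, ?_⟩
      rw [abs_tent_sub_tent hs (by simp)]
      nlinarith
  · obtain ⟨u', hu', v', hv', hle⟩ := key h
    refine ⟨u', hu', v', hv', le_trans ?_ hle⟩
    have := mul_nonneg hs.le (abs_nonneg (u - v))
    linarith

theorem core_subset_image_tent {s : ℝ} (hs1 : 1 < s) :
    Icc (crit s 2) (crit s 1) ⊆ tent s '' Icc (1 / 2) (crit s 1) := by
  have hs : 0 < s := by linarith
  have h : (1 / 2 : ℝ) ≤ crit s 1 := by rw [crit_one hs]; linarith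
  rw [← uIcc_of_ge h, image_tent_uIcc_half hs, ← crit_succ s 1]
  exact Icc_subset_uIcc

theorem core_subset_proj_of_succ {s : ℝ} (hs1 : 1 < s) {J : Set ℝ} {H : Set (ℕ → ℝ)}
    (hH : IsSubcontinuum H (invLim s J)) {n : ℕ}
    (h : Icc (1 / 2) (crit s 1) ⊆ proj (n + 1) H) : Icc (crit s 2) (crit s 1) ⊆ proj n H := by
  intro y hy
  obtain ⟨z, hz, rfl⟩ := core_subset_image_tent hs1 hy
  exact tent_mem_proj hH.1 (h hz)

/-- Two consecutive folds put both `1/2` and `c_1` into the projection at `n + 1`, and `T` maps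
`[1/2, c_1]` onto the core. -/
theorem half_not_mem_proj_or {s : ℝ} (hs1 : 1 < s) {J : Set ℝ} {H : Set (ℕ → ℝ)}
    (hH : IsSubcontinuum H (invLim s J)) {n : ℕ} (h : ¬ Icc (crit s 2) (crit s 1) ⊆ proj n H) :
    (1 / 2 : ℝ) ∉ proj (n + 1) H ∨ (1 / 2 : ℝ) ∉ proj (n + 2) H := by
  by_contra! hcon
  refine h (core_subset_proj_of_succ hs1 hH ((ordConnected_proj hH (n + 1)).out hcon.1 ?_))
  rw [crit_succ, crit_zero]
  exact tent_mem_proj hH.1 hcon.2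

theorem exists_expanded_pair_two {s : ℝ} (hs1 : 1 < s) {J : Set ℝ} {H : Set (ℕ → ℝ)}
    (hH : IsSubcontinuum H (invLim s J)) {n : ℕ} (h : ¬ Icc (crit s 2) (crit s 1) ⊆ proj n H)
    {u v : ℝ} (hu : u ∈ proj (n + 2) H) (hv : v ∈ proj (n + 2) H) :
    ∃ u' ∈ proj n H, ∃ v' ∈ proj n H, s ^ 2 / 2 * |u - v| ≤ |u' - v'| := by
  have hs : 0 < s := by linarith
  rcases half_not_mem_proj_or hs1 hH h with h1 | h1
  · obtain ⟨u₁, hu₁, v₁, hv₁, hle₁⟩ := (exists_expanded_pair hs hH (n + 1) hu hv).1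
    obtain ⟨u₂, hu₂, v₂, hv₂, hle₂⟩ := (exists_expanded_pair hs hH n hu₁ hv₁).2 h1
    exact ⟨u₂, hu₂, v₂, hv₂, by nlinarith⟩
  · obtain ⟨u₁, hu₁, v₁, hv₁, hle₁⟩ := (exists_expanded_pair hs hH (n + 1) hu hv).2 h1
    obtain ⟨u₂, hu₂, v₂, hv₂, hle₂⟩ := (exists_expanded_pair hs hH n hu₁ hv₁).1
    exact ⟨u₂, hu₂, v₂, hv₂, by nlinarith⟩

theorem half_not_mem_proj_of_proper {s : ℝ} (hs1 : 1 < s) (hs2 : s ≤ 2) (hsq : √2 < s)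
    (hinf : (range (crit s)).Infinite) (hlong : LongBranched s) {H : Set (ℕ → ℝ)}
    (hH : IsSubcontinuum H (coreSpace s)) (hne : H ≠ coreSpace s) :
    ∃ N, ∀ n > N, (1 / 2 : ℝ) ∉ proj n H := by
  have hs : 0 < s := by linarith
  obtain ⟨δ, hδ, hD⟩ := hlong
  obtain ⟨n₀, hn₀⟩ : ∃ n₀, ¬ Icc (crit s 2) (crit s 1) ⊆ proj n₀ H := by
    by_contra! hcon
    exact hne (hH.1.antisymm fun x hx => mem_of_forall_proj_mem hH.2.1.isClosed hH.1 hx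
      fun n => hcon n (hx.1 n))
  have hproper : ∀ k, ¬ Icc (crit s 2) (crit s 1) ⊆ proj (n₀ + k) H := by
    intro k
    induction k with
    | zero => exact hn₀
    | succ k ih =>
      exact fun h => ih (core_subset_proj_of_succ hs1 hH
        ((Icc_subset_Icc_left (crit_two_lt hs1).le).trans h))
  have hpow : ∀ M n, n₀ ≤ n → ∀ u ∈ proj (n + 2 * M) H, ∀ v ∈ proj (n + 2 * M) H,
      (s ^ 2 / 2) ^ M * |u - v| ≤ 1 := by
    intro M
    induction M with
    | zero =>
      rintro n - _ ⟨x, hx, rfl⟩ _ ⟨y, hy, rfl⟩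
      have h1 := core_subset hs1 hs2 ((hH.1 hx).1 n)
      have h2 := core_subset hs1 hs2 ((hH.1 hy).1 n)
      simp only [pow_zero, one_mul, mul_zero, add_zero]
      exact abs_le.2 ⟨by linarith [h1.1, h2.2], by linarith [h1.2, h2.1]⟩
    | succ M ih =>
      intro n hn u hu v hv
      obtain ⟨k, hk⟩ := Nat.exists_eq_add_of_le (show n₀ ≤ n + 2 * M by omega)
      obtain ⟨u', hu', v', hv', hle⟩ := exists_expanded_pair_two hs1 hH (n := n + 2 * M)
        (by rw [hk]; exact hproper k) hu hv
      refine le_trans ?_ (ih n hn u' hu' v' hv')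
      rw [pow_succ, mul_assoc]
      exact mul_le_mul_of_nonneg_left hle (by positivity)
  have hgrow : 1 < s ^ 2 / 2 := by
    have := (Real.sqrt_lt' hs).1 hsq
    linarith
  obtain ⟨M, hM⟩ := pow_unbounded_of_one_lt (s / δ) hgrow
  rw [div_lt_iff₀ hδ] at hM
  by_contra! hcon
  obtain ⟨a, ha, hha⟩ := hcon (n₀ + 2 * M)
  obtain ⟨b, hb, hhb⟩ := hcon a
  obtain ⟨u, hu, v, hv, huv⟩ := exists_far_pair hs1 hinf hD hH hb hha hhb
  -- Level `a` lies `M` double steps above a level that is still at least `n₀`, so the length `δ /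
  -- s` found there would expand beyond `1`.
  obtain ⟨n, hn, rfl⟩ : ∃ n, n₀ ≤ n ∧ a = n + 2 * M := ⟨a - 2 * M, by omega, by omega⟩
  have h1 := hpow M n hn u hu v hv
  have h2 : (s ^ 2 / 2) ^ M * δ ≤ s * ((s ^ 2 / 2) ^ M * |u - v|) := by
    rw [mul_left_comm]
    exact mul_le_mul_of_nonneg_left huv (by positivity)
  nlinarith

/-- Beyond `N` the map `T` is injective on each projection, so coordinate `N` determines the point
and embeds `H` as a compact interval. -/
theorem isArc_of_half_not_mem_proj {s : ℝ} (hs : 0 < s) {J : Set ℝ} {H : Set (ℕ → ℝ)}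
    (hH : IsSubcontinuum H (invLim s J)) (hnt : H.Nontrivial) {N : ℕ}
    (hN : ∀ n > N, (1 / 2 : ℝ) ∉ proj n H) : IsArc H := by
  have hinj : InjOn (fun x : ℕ → ℝ => x N) H := by
    intro x hx y hy hxy
    have hup : ∀ k, x (N + k) = y (N + k) := by
      intro k
      induction k with
      | zero => exact hxy
      | succ k ih =>
        have h1 := abs_tent_sub_tent hs (mul_nonneg_of_half_not_mem (ordConnected_proj hH _)
          (hN (N + k + 1) (by omega)) ⟨x, hx, rfl⟩ ⟨y, hy, rfl⟩)
        simp only [] at h1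
        rw [(hH.1 hx).2, (hH.1 hy).2, ih, sub_self, abs_zero] at h1
        have := (mul_eq_zero.1 h1.symm).resolve_left hs.ne'
        exact sub_eq_zero.1 (abs_eq_zero.1 this)
    ext i
    exact eq_of_le_of_eq (hH.1 hx) (hH.1 hy) (hup i) (by omega)
  have hP : proj N H = Icc (sInf (proj N H)) (sSup (proj N H)) :=
    eq_Icc_of_connected_compact (hH.2.2.image _ (continuous_apply N).continuousOn)
      (hH.2.1.image (continuous_apply N))
  have hlt : sInf (proj N H) < sSup (proj N H) := by
    have := hnt.image_of_injOn hinj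
    change (proj N H).Nontrivial at this
    rw [hP] at this
    obtain ⟨a, ha, b, hb, hab⟩ := this
    exact not_le.1 fun h => hab (subsingleton_Icc_of_ge h ha hb)
  have : CompactSpace H := isCompact_iff_compactSpace.1 hH.2.1
  let f : H ≃ proj N H := Equiv.Set.imageOfInjOn _ H hinj
  have hf : Continuous f :=
    ((continuous_apply N).comp continuous_subtype_val).subtype_mk _
  exact ⟨((hf.homeoOfEquivCompactToT2.trans (Homeomorph.setCongr hP)).trans
    (iccHomeoI _ _ hlt)).symm⟩

/-! ### Basic arcs -/

/-- `r` is an admissible endpoint of the image `U` of a monotone branch: either `0`, or a point of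
the critical orbit whose level of the Hofbauer tower contains its side of `U`. -/
def IsBranchEnd (s r : ℝ) (U : Set ℝ) : Prop :=
  r = 0 ∨ ∃ a, r = crit s (a + 1) ∧ ∀ y ∈ U, 0 ≤ (y - 1 / 2) * (r - 1 / 2) → y ∈ D s a

/-- The parameters `t` whose first `n` preimages along `e` stay in `[0, 1]` and on the sides
prescribed by `e`. -/
def stage (s : ℝ) (e : ℕ → Bool) (n : ℕ) : Set ℝ :=
  {t | (∀ i ≤ n, branch s e t i ∈ Icc (0 : ℝ) 1) ∧ ∀ i < n, OnSide (e i) (branch s e t (i + 1))}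

/-- This lets the stages be built from the front of the itinerary: stage `n + 1` for `e` receives
the `T`-image of the part of stage `n` for the shifted `e` lying on side `e 0`. -/
theorem branch_tent {s : ℝ} (hs : 0 < s) {e : ℕ → Bool} {u : ℝ} (hu : OnSide (e 0) u) (n : ℕ) :
    branch s e (tent s u) (n + 1) = branch s (fun i => e (i + 1)) u n := by
  induction n with
  | zero =>
    rw [onSide_iff] at hu
    simp only [branch]
    split_ifs at * with h
    · rw [tent_of_ge hs hu]; field_simp; ring
    · rw [tent_of_le hs hu]; field_simp
  | succ n ih => rw [branch_succ, ih, branch_succ]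

theorem tent_mem_stage_succ {s : ℝ} (hs : 0 < s) (hs2 : s ≤ 2) {e : ℕ → Bool} {u : ℝ} {n : ℕ}
    (hu : OnSide (e 0) u) (h : u ∈ stage s (fun i => e (i + 1)) n) :
    tent s u ∈ stage s e (n + 1) := by
  refine ⟨fun i hi => ?_, fun i hi => ?_⟩
  · cases i with
    | zero => exact tent_mapsTo hs hs2 (h.1 0 (Nat.zero_le _))
    | succ i => rw [branch_tent hs hu]; exact h.1 i (by omega)
  · rw [branch_tent hs hu]
    cases i with
    | zero => exact hu
    | succ i => exact h.2 i (by omega)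

theorem IsBranchEnd.ne_half {s r : ℝ} {U : Set ℝ} (hinf : (range (crit s)).Infinite)
    (h : IsBranchEnd s r U) : r ≠ 1 / 2 := by
  rcases h with rfl | ⟨a, rfl, -⟩
  · norm_num
  · exact crit_ne_of_infinite hinf a

theorem isBranchEnd_crit_one {s : ℝ} (hs1 : 1 < s) {U : Set ℝ} (hU : U ⊆ Iic (s / 2)) :
    IsBranchEnd s (crit s 1) U := by
  refine Or.inr ⟨0, rfl, fun y hy hside => ?_⟩
  rw [crit_one (by linarith)] at hside
  rw [D_zero hs1]
  refine ⟨?_, hU hy⟩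
  by_contra! hlt
  exact absurd (mul_neg_of_neg_of_pos (sub_neg.2 hlt) (show 0 < s / 2 - 1 / 2 by linarith))
    (not_lt.2 hside)

theorem image_tent_subset_Iic {s : ℝ} (hs : 0 < s) (U : Set ℝ) : tent s '' U ⊆ Iic (s / 2) := by
  rintro _ ⟨y, -, rfl⟩; exact tent_le hs y

theorem IsBranchEnd.image_tent {s r : ℝ} {U : Set ℝ} (hs : 0 < s)
    (hinf : (range (crit s)).Infinite)
    (h : IsBranchEnd s r U) (hU : ∀ y ∈ U, 0 ≤ (y - 1 / 2) * (r - 1 / 2)) :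
    IsBranchEnd s (tent s r) (tent s '' U) := by
  rcases h with rfl | ⟨a, rfl, h⟩
  · exact Or.inl (by simp [tent_of_le hs (show (0 : ℝ) ≤ 1 / 2 by norm_num)])
  · refine Or.inr ⟨a + 1, (crit_succ s (a + 1)).symm, ?_⟩
    rintro _ ⟨y, hy, rfl⟩ -
    exact tent_mem_D_succ hs hinf (h y hy (hU y hy)) (hU y hy)

theorem IsBranchEnd.mono {s r : ℝ} {U V : Set ℝ} (h : IsBranchEnd s r U) (hVU : V ⊆ U) :
    IsBranchEnd s r V := by
  rcases h with h | ⟨a, hr, h⟩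
  · exact Or.inl h
  · exact Or.inr ⟨a, hr, fun y hy => h y (hVU hy)⟩

theorem IsBranchEnd.le_mul_abs {s δ r : ℝ} {U : Set ℝ} (hs1 : 1 < s)
    (hδ : ∀ n, δ ≤ Metric.diam (D s n)) (h : IsBranchEnd s r U) (hU : (1 / 2 : ℝ) ∈ U) :
    δ ≤ s * |r - 1 / 2| := by
  rcases h with rfl | ⟨a, rfl, h⟩
  · have := hδ 0
    rw [D_zero hs1, Real.diam_Icc (by linarith)] at this
    rw [zero_sub, abs_neg, abs_of_pos (by norm_num)]
    linarith
  · exact le_abs_of_half_mem_D (by linarith) hδ (h _ hU (by simp))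

/-- The conclusion of the induction step: an interval of parameters around `x` inside a stage. -/
def StageInterval (s δ : ℝ) (e : ℕ → Bool) (n : ℕ) (x p q : ℝ) : Prop :=
  x ∈ uIcc p q ∧ uIcc p q ⊆ stage s e n ∧ δ ≤ |p - q| ∧
    IsBranchEnd s p (uIcc p q) ∧ IsBranchEnd s q (uIcc p q)

theorem StageInterval.symm {s δ : ℝ} {e : ℕ → Bool} {n : ℕ} {x p q : ℝ}
    (h : StageInterval s δ e n x p q) : StageInterval s δ e n x q p := by
  unfold StageInterval at *
  rw [uIcc_comm q p, abs_sub_comm q p]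
  exact ⟨h.1, h.2.1, h.2.2.1, h.2.2.2.2, h.2.2.2.1⟩

theorem onSide_of_mul_nonneg {b : Bool} {y z : ℝ} (hz : OnSide b z) (hz0 : z ≠ 1 / 2)
    (h : 0 ≤ (y - 1 / 2) * (z - 1 / 2)) : OnSide b y := by
  rw [onSide_iff] at *
  split_ifs at *
  · have : 0 < z - 1 / 2 := sub_pos.2 (lt_of_le_of_ne hz hz0.symm)
    linarith [nonneg_of_mul_nonneg_left h this]
  · have : 0 < 1 / 2 - z := sub_pos.2 (lt_of_le_of_ne hz hz0)
    have h' : 0 ≤ (1 / 2 - y) * (1 / 2 - z) := by linarith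
    linarith [nonneg_of_mul_nonneg_left h' this]

theorem mul_half_nonneg_of_mem_uIcc {a b y : ℝ} (h : 0 ≤ (a - 1 / 2) * (b - 1 / 2))
    (hy : y ∈ uIcc a b) : 0 ≤ (y - 1 / 2) * (a - 1 / 2) := by
  rcases mul_nonneg_iff.1 h with ⟨h1, h2⟩ | ⟨h1, h2⟩
  · exact mul_nonneg (by linarith [(le_min (by linarith) (by linarith) : (1 / 2 : ℝ) ≤ min a b), hy.1]) h1
  · exact mul_nonneg_of_nonpos_of_nonpos
      (by linarith [(max_le (by linarith) (by linarith) : max a b ≤ (1 / 2 : ℝ)), hy.2]) h1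

/-- A cut does not erode length: the kept half runs from `p` to `1/2`, and its image has length `s *
|p - 1/2|`, at least `δ` because `p` is an admissible end. -/
theorem stageInterval_of_cut {s δ : ℝ} (hs1 : 1 < s) (hs2 : s ≤ 2)
    (hinf : (range (crit s)).Infinite)
    (hδ : ∀ n, δ ≤ Metric.diam (D s n)) {e : ℕ → Bool} {n : ℕ} {x p q : ℝ}
    (h : StageInterval s δ (fun i => e (i + 1)) n x p q) (hx : OnSide (e 0) x)
    (hp : OnSide (e 0) p) (hpq : (p - 1 / 2) * (q - 1 / 2) < 0) :
    StageInterval s δ e (n + 1) (tent s x) (tent s p) (crit s 1) := by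
  have hs : 0 < s := by linarith
  obtain ⟨hxU, hst, hlen, hep, heq⟩ := h
  have hp0 := hep.ne_half hinf
  have hcU : (1 / 2 : ℝ) ∈ uIcc p q := by
    rw [mem_uIcc]
    rcases mul_neg_iff.1 hpq with h | h
    · exact Or.inr ⟨by linarith, by linarith⟩
    · exact Or.inl ⟨by linarith, by linarith⟩
  have hsub : uIcc p (1 / 2) ⊆ uIcc p q := uIcc_subset_uIcc left_mem_uIcc hcU
  have hsame : ∀ y ∈ uIcc p (1 / 2), 0 ≤ (y - 1 / 2) * (p - 1 / 2) := fun y hy =>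
    mul_half_nonneg_of_mem_uIcc (by simp) hy
  have hxV : x ∈ uIcc p (1 / 2) := by
    rw [onSide_iff] at hx hp
    rw [mem_uIcc] at *
    split_ifs at *
    · have : q < 1 / 2 := by
        by_contra! hq
        exact absurd (mul_nonneg (sub_nonneg.2 hp) (sub_nonneg.2 hq)) (not_le.2 hpq)
      rcases hxU with h | h
      · linarith [h.1, h.2]
      · exact Or.inr ⟨hx, h.2⟩
    · have : 1 / 2 < q := by
        by_contra! hq
        exact absurd (mul_nonneg_of_nonpos_of_nonpos (sub_nonpos.2 hp) (sub_nonpos.2 hq))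
          (not_le.2 hpq)
      rcases hxU with h | h
      · exact Or.inl ⟨h.1, hx⟩
      · linarith [h.1, h.2]
  unfold StageInterval
  rw [← image_tent_uIcc_half hs]
  refine ⟨mem_image_of_mem _ hxV, ?_, ?_, (hep.mono hsub).image_tent hs hinf hsame,
    isBranchEnd_crit_one hs1 (image_tent_subset_Iic hs _)⟩
  · rintro _ ⟨y, hy, rfl⟩
    exact tent_mem_stage_succ hs hs2 (onSide_of_mul_nonneg hp hp0 (hsame y hy)) (hst (hsub hy))
  · rw [crit_succ s 0, crit_zero, abs_tent_sub_tent hs (by simp)]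
    exact hep.le_mul_abs hs1 hδ hcU

/-- The induction quantifies over all `e` and `x` because each step passes to the shifted itinerary
and the tail. The interval is either cut, with the tower restoring length `δ`, or stretched by `s`.
-/
theorem exists_stageInterval {s δ : ℝ} (hs1 : 1 < s) (hs2 : s ≤ 2)
    (hinf : (range (crit s)).Infinite) (hδ0 : 0 < δ) (hδ : ∀ n, δ ≤ Metric.diam (D s n)) (n : ℕ) :
    ∀ (e : ℕ → Bool) (x : ℕ → ℝ), x ∈ space s → IsLeftItinerary x e →
      ∃ p q, StageInterval s δ e n (x 0) p q := by
  have hs : 0 < s := by linarith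
  induction n with
  | zero =>
    intro e x hx _
    have hx0 : x 0 ≤ s / 2 := by rw [← hx.2 0]; exact tent_le hs _
    have hu : uIcc 0 (crit s 1) = Icc 0 (s / 2) := by
      rw [crit_one hs, uIcc_of_le (by linarith)]
    refine ⟨0, crit s 1, ?_⟩
    unfold StageInterval
    rw [hu]
    refine ⟨⟨(hx.1 0).1, hx0⟩, fun t ht => ⟨fun i hi => ?_, fun i hi => absurd hi (by omega)⟩, ?_,
      Or.inl rfl, isBranchEnd_crit_one hs1 fun y hy => hy.2⟩
    · obtain rfl : i = 0 := by omega
      exact ⟨ht.1, ht.2.trans (by linarith)⟩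
    · have := hδ 0
      rw [D_zero hs1, Real.diam_Icc (by linarith)] at this
      rw [zero_sub, abs_neg, crit_one hs, abs_of_pos (by linarith)]
      linarith
  | succ n ih =>
    intro e x hx he
    obtain ⟨p, q, h⟩ := ih (fun i => e (i + 1)) (fun i => x (i + 1))
      ⟨fun i => hx.1 (i + 1), fun i => hx.2 (i + 1)⟩ fun i => he (i + 1)
    have hx1 : OnSide (e 0) (x 1) := he 0
    rw [← hx.2 0]
    have hp0 := h.2.2.2.1.ne_half hinf
    have hq0 := h.2.2.2.2.ne_half hinf
    rcases lt_or_ge ((p - 1 / 2) * (q - 1 / 2)) 0 with hpq | hpq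
    · have hor : OnSide (e 0) p ∨ OnSide (e 0) q := by
        simp only [onSide_iff]
        rcases mul_neg_iff.1 hpq with h | h <;> split_ifs
        · left; linarith
        · right; linarith
        · right; linarith
        · left; linarith
      rcases hor with hp | hq
      · exact ⟨_, _, stageInterval_of_cut hs1 hs2 hinf hδ h hx1 hp hpq⟩
      · exact ⟨_, _, stageInterval_of_cut hs1 hs2 hinf hδ h.symm hx1 hq (by rwa [mul_comm])⟩
    · obtain ⟨hxU, hst, hlen, hep, heq⟩ := h
      have hsp : ∀ y ∈ uIcc p q, 0 ≤ (y - 1 / 2) * (p - 1 / 2) := fun y hy =>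
        mul_half_nonneg_of_mem_uIcc hpq hy
      have hsq : ∀ y ∈ uIcc p q, 0 ≤ (y - 1 / 2) * (q - 1 / 2) := fun y hy =>
        mul_half_nonneg_of_mem_uIcc (by rwa [mul_comm]) (by rwa [uIcc_comm])
      have hhalf : (1 / 2 : ℝ) ∉ uIcc p q := by
        rw [mem_uIcc]
        rcases mul_nonneg_iff.1 hpq with ⟨h1, h2⟩ | ⟨h1, h2⟩
        · have h1' := lt_of_le_of_ne (sub_nonneg.1 h1) hp0.symm
          have h2' := lt_of_le_of_ne (sub_nonneg.1 h2) hq0.symm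
          rintro (h | h) <;> linarith [h.1, h.2]
        · have h1' := lt_of_le_of_ne (sub_nonpos.1 h1) hp0
          have h2' := lt_of_le_of_ne (sub_nonpos.1 h2) hq0
          rintro (h | h) <;> linarith [h.1, h.2]
      refine ⟨tent s p, tent s q, ?_⟩
      unfold StageInterval
      rw [← image_tent_uIcc hs hpq]
      refine ⟨mem_image_of_mem _ hxU, ?_, ?_, hep.image_tent hs hinf hsp,
        heq.image_tent hs hinf hsq⟩
      · rintro _ ⟨y, hy, rfl⟩
        exact tent_mem_stage_succ hs hs2 (onSide_of_mul_nonneg hx1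
          (fun h => hhalf (h ▸ hxU))
          (mul_nonneg_of_half_not_mem ordConnected_uIcc hhalf hy hxU)) (hst hy)
      · rw [abs_tent_sub_tent hs hpq]
        nlinarith [abs_nonneg (p - q)]

/-- The parameters of the points with left itinerary `e`. -/
def itineraryParams (s : ℝ) (e : ℕ → Bool) : Set ℝ :=
  {t | branch s e t ∈ space s ∧ IsLeftItinerary (branch s e t) e}

theorem isClosed_isLeftItinerary (e : ℕ → Bool) : IsClosed {x : ℕ → ℝ | IsLeftItinerary x e} := by
  have : {x : ℕ → ℝ | IsLeftItinerary x e}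
      = ⋂ i, {x | if e i then 1 / 2 ≤ x (i + 1) else x (i + 1) ≤ 1 / 2} := by
    ext x
    simp only [mem_ofPred_eq, mem_iInter]
    exact forall_congr' fun i => onSide_iff
  rw [this]
  refine isClosed_iInter fun i => ?_
  cases e i
  · simpa using isClosed_le (continuous_apply (i + 1)) continuous_const
  · simpa using isClosed_le continuous_const (continuous_apply (i + 1))

/-- The itinerary condition is closed, so the closure in the definition adds nothing, and coordinate
`0` parametrizes the set. -/
theorem basicArc_eq_image {s : ℝ} (hs : 0 < s) (e : ℕ → Bool) :
    basicArc s e = branch s e '' itineraryParams s e := by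
  have hcl : IsClosed {x | x ∈ space s ∧ IsLeftItinerary x e} :=
    (isClosed_invLim s isClosed_Icc).inter (isClosed_isLeftItinerary e)
  rw [basicArc, hcl.closure_eq]
  ext x
  constructor
  · rintro ⟨hx, he⟩
    have := branch_apply_zero_eq hs hx.2 he
    exact ⟨x 0, by rw [itineraryParams, mem_ofPred_eq, this]; exact ⟨hx, he⟩, this⟩
  · rintro ⟨t, ht, rfl⟩
    exact ht

theorem isCompact_itineraryParams (s : ℝ) (e : ℕ → Bool) : IsCompact (itineraryParams s e) := by
  refine isCompact_Icc.of_isClosed_subset (s := Icc (0 : ℝ) 1)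
    (((isClosed_invLim s isClosed_Icc).inter (isClosed_isLeftItinerary e)).preimage
      (continuous_branch s e)) fun t ht => ht.1.1 0

theorem mem_itineraryParams_of_mem_stage {s : ℝ} (hs : 0 < s) {e : ℕ → Bool} {t : ℝ}
    (h : ∀ n, t ∈ stage s e n) : t ∈ itineraryParams s e :=
  have hside : ∀ n, OnSide (e n) (branch s e t (n + 1)) := fun n => (h (n + 1)).2 n n.lt_succ_self
  ⟨⟨fun n => (h n).1 n le_rfl, fun n => tent_branch hs (hside n)⟩, hside⟩

/-- Every branch is affine in the parameter, and each condition confines it to an interval. -/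
theorem ordConnected_itineraryParams {s : ℝ} (hs : 0 < s) (e : ℕ → Bool) :
    OrdConnected (itineraryParams s e) := by
  refine ordConnected_iff_uIcc_subset.2 fun t ht v hv u hu => ?_
  have hm := branch_mem_uIcc hs e hu
  refine mem_itineraryParams_of_mem_stage hs fun n => ⟨fun i _ =>
    ordConnected_Icc.uIcc_subset (ht.1.1 i) (hv.1.1 i) (hm i), fun i _ => ?_⟩
  have h1 := onSide_iff.1 (show OnSide _ _ from ht.2 i)
  have h2 := onSide_iff.1 (show OnSide _ _ from hv.2 i)
  rw [onSide_iff]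
  split_ifs at *
  · exact (le_min h1 h2).trans (hm (i + 1)).1
  · exact (hm (i + 1)).2.trans (max_le h1 h2)

theorem stage_anti (s : ℝ) (e : ℕ → Bool) {m n : ℕ} (h : m ≤ n) : stage s e n ⊆ stage s e m :=
  fun _ ht => ⟨fun i hi => ht.1 i (hi.trans h), fun i hi => ht.2 i (hi.trans_le h)⟩

/-- An interval of length at least `δ` around `x 0` reaches `δ / 2` to one side. Since stages
decrease, once the right-hand point fails at some stage, the left-hand one must belong to all of
them. -/
theorem exists_ne_mem_itineraryParams {s : ℝ} (hs1 : 1 < s) (hs2 : s ≤ 2)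
    (hinf : (range (crit s)).Infinite) (hlong : LongBranched s) {e : ℕ → Bool} {x : ℕ → ℝ}
    (hx : x ∈ space s) (he : IsLeftItinerary x e) : ∃ t ∈ itineraryParams s e, t ≠ x 0 := by
  obtain ⟨δ, hδ, hD⟩ := hlong
  have hn : ∀ n, x 0 + δ / 2 ∈ stage s e n ∨ x 0 - δ / 2 ∈ stage s e n := by
    intro n
    obtain ⟨p, q, hxU, hst, hlen, -, -⟩ := exists_stageInterval hs1 hs2 hinf hδ hD n e x hx he
    by_contra! hcon
    have h1 := fun h => hcon.1 (hst h)
    have h2 := fun h => hcon.2 (hst h)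
    rw [← max_sub_min_eq_abs, max_comm, min_comm] at hlen
    have hlo : min p q ≤ x 0 := hxU.1
    have hhi : x 0 ≤ max p q := hxU.2
    have h1' : max p q < x 0 + δ / 2 := by
      by_contra! h; exact h1 ⟨hlo.trans (by linarith), h⟩
    have h2' : x 0 - δ / 2 < min p q := by
      by_contra! h; exact h2 ⟨h, le_trans (by linarith) hhi⟩
    linarith
  by_cases hall : ∀ n, x 0 + δ / 2 ∈ stage s e n
  · exact ⟨_, mem_itineraryParams_of_mem_stage (by linarith) hall, by linarith⟩
  · push Not at hall
    obtain ⟨N, hN⟩ := hall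
    refine ⟨x 0 - δ / 2, mem_itineraryParams_of_mem_stage (by linarith) fun n => ?_, by linarith⟩
    exact stage_anti s e (le_max_left n N) ((hn (max n N)).resolve_left
      fun h => hN (stage_anti s e (le_max_right n N) h))

/-! ### Flat endpoints -/

theorem isArcEnd_branch_image {s : ℝ} (e : ℕ → Bool) {a b : ℝ} (hab : a ≠ b) :
    IsArcEnd (branch s e '' uIcc a b) (branch s e a) := by
  let g : ℝ → ℝ := fun u => a + u * (b - a)
  have hba : b - a ≠ 0 := sub_ne_zero.2 hab.symm
  have hg : g '' Icc 0 1 = uIcc a b := by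
    rw [← segment_eq_uIcc, segment_eq_image']
    rfl
  have hinj : InjOn (fun u => branch s e (g u)) (Icc 0 1) := by
    intro u _ v _ huv
    have : g u = g v := congrFun huv 0
    exact mul_right_cancel₀ hba (add_left_cancel this)
  have hcont : Continuous fun u => branch s e (g u) :=
    (continuous_branch s e).comp (by fun_prop)
  let f := Equiv.Set.imageOfInjOn _ (Icc (0 : ℝ) 1) hinj
  have hf : Continuous f := (hcont.comp continuous_subtype_val).subtype_mk _
  have himg : (fun u => branch s e (g u)) '' Icc 0 1 = branch s e '' uIcc a b := by
    rw [← hg, image_image]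
  refine ⟨hf.homeoOfEquivCompactToT2.trans (Homeomorph.setCongr himg), ?_⟩
  change branch s e (g 0) = _
  simp [g]

/-- The parameters form a non-degenerate compact interval containing `x 0`; an interior position is
excluded by `branch_not_mem_endpoints`. -/
theorem endpoints_subset_flatEndpoints {s : ℝ} (hs1 : 1 < s) (hs2 : s ≤ 2)
    (hinf : (range (crit s)).Infinite) (hlong : LongBranched s) :
    endpoints (space s) ⊆ flatEndpoints s := by
  intro x hx
  have hs : 0 < s := by linarith
  obtain ⟨e, he⟩ := exists_leftItinerary x
  have hbx := branch_apply_zero_eq hs hx.1.2 he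
  have hx0 : x 0 ∈ itineraryParams s e := by
    rw [itineraryParams, mem_ofPred_eq, hbx]; exact ⟨hx.1, he⟩
  obtain ⟨t, ht, htx⟩ := exists_ne_mem_itineraryParams hs1 hs2 hinf hlong hx.1 he
  obtain ⟨p, q, hpq⟩ : ∃ p q, itineraryParams s e = Icc p q :=
    ⟨_, _, eq_Icc_of_connected_compact ⟨⟨_, hx0⟩,
      (ordConnected_itineraryParams hs e).isPreconnected⟩ (isCompact_itineraryParams s e)⟩
  rw [hpq] at hx0 ht
  have hlt : p < q := not_le.1 fun h => htx (subsingleton_Icc_of_ge h ht hx0)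
  refine ⟨hx, e, he, ?_⟩
  rw [basicArc_eq_image hs, hpq, ← hbx]
  rcases eq_or_lt_of_le hx0.1 with h1 | h1
  · rw [← uIcc_of_le hlt.le, ← h1]
    exact isArcEnd_branch_image e hlt.ne
  · rcases eq_or_lt_of_le hx0.2 with h2 | h2
    · rw [← uIcc_of_ge hlt.le, h2]
      exact isArcEnd_branch_image e hlt.ne'
    · refine absurd hx ?_
      rw [← hbx]
      exact branch_not_mem_endpoints h1 h2 fun u hu => (hpq.ge hu).1

end TentInvLim

end

theorem proposition4p7 (s : ℝ) (hs1 : 1 < s) (hs2 : s ≤ 2)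
    (hinf : (Set.range (TentInvLim.crit s)).Infinite)
    (hlong : TentInvLim.LongBranched s) :
    (√2 < s → ∀ H : Set (ℕ → ℝ),
      TentInvLim.IsSubcontinuum H (TentInvLim.coreSpace s) → H ≠ TentInvLim.coreSpace s →
      H.Nontrivial → TentInvLim.IsArc H) ∧
    ((TentInvLim.endpoints (TentInvLim.space s) ∩ TentInvLim.coreSpace s).Nonempty ↔
      TentInvLim.CritRecurrent s) ∧
    (TentInvLim.CritRecurrent s →
      TentInvLim.endpoints (TentInvLim.space s) = TentInvLim.flatEndpoints s) := by
  refine ⟨fun hsq H hH hne hnt => ?_, ⟨?_, ?_⟩, fun _ => ?_⟩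
  · obtain ⟨N, hN⟩ := TentInvLim.half_not_mem_proj_of_proper hs1 hs2 hsq hinf hlong hH hne
    exact TentInvLim.isArc_of_half_not_mem_proj (by linarith) hH hnt hN
  · exact TentInvLim.recurrent_of_endpoint hs1 (TentInvLim.lt_two_of_infinite hs2 hinf) hinf
  · exact TentInvLim.exists_endpoint_of_recurrent hs1 hs2
  · exact (TentInvLim.endpoints_subset_flatEndpoints hs1 hs2 hinf hlong).antisymm fun x hx => hx.1
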